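/- Let $\varphi=(1+\sqrt5)/2$. Let $A$ be the Hurt--Sada array: row $0$ is $A[0,k]=k$ for $k\ge 0$, and for $n\ge 1$ row $n$ is obtained from row $n-1$ by taking the unique occurrence of $n$ in row $n-1$ and shifting it $n$ positions to the right (the $n$ entries it jumps over each move one position to the left). Let $d'(n)=A[n-1,n]$ for $n\ge 1$, and $d'(0)=0$. For a binary word $w=a_1a_2\cdots a_t$ put $[w]=\sum_{i=1}^{t}a_iF_{t+2-i}$, where $F_0=0$, $F_1=1$, $F_i=F_{i-1}+F_{i-2}$; $w$ is a Zeckendorf representation of $[w]$, possibly with leading zeros, if it has no two adjacent $1$s. There is a deterministic finite automaton with $6$ states, reading Zeckendorf representations (most significant digit first), that decides whether $d'(n)\ge n$: a binary word $w$ is accepted if and only if it is a Zeckendorf representation of an integer $n\ge 0$ with $d'(n)\ge n$. Furthermore, for every $n\ge 0$: if $d'(n)\ge n$ then $d'(n)=\lfloor(2\varphi-2)n+\tfrac12\rfloor$, and if $d'(n)<n$ then $d'(n)=\lfloor(4-2\varphi)n\rfloor$. -/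

import Mathlib

/-- The sequence obtained from `r` by moving the entry in position `i` to the right by `k`
positions; the `k` entries it jumps over each move one position to the left. -/
def shiftRight (r : ℕ → ℕ) (i k : ℕ) : ℕ → ℕ := fun j =>
  if j < i then r j
  else if j < i + k then r (j + 1)
  else if j = i + k then r i
  else r j

/-- The (first) position at which the value `v` occurs in the sequence `r`. -/
noncomputable def position (r : ℕ → ℕ) (v : ℕ) : ℕ := sInf {i | r i = v}

/-- The Hurt-Sada array `A[n, k]`: row `0` is `0, 1, 2, …`, and row `n + 1` is row `n` with the
entry `n + 1` moved to the right by `n + 1` positions. -/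
noncomputable def hurtSada : ℕ → ℕ → ℕ
  | 0 => fun k => k
  | n + 1 => shiftRight (hurtSada n) (position (hurtSada n) (n + 1)) (n + 1)

theorem shiftRight_bijective {r : ℕ → ℕ} (hr : Function.Bijective r) (i k : ℕ) :
    Function.Bijective (shiftRight r i k) := by
  constructor
  · intro a b h
    unfold shiftRight at h
    split_ifs at h <;> have := hr.1 h <;> omega
  · intro v
    obtain ⟨j, rfl⟩ := hr.2 v
    by_cases h1 : j < i
    · exact ⟨j, by simp [shiftRight, h1]⟩
    by_cases h2 : j = i
    · exact ⟨i + k, by simp [shiftRight, h2]⟩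
    by_cases h3 : j ≤ i + k
    · refine ⟨j - 1, ?_⟩
      have e1 : ¬ (j - 1 < i) := by omega
      have e2 : j - 1 < i + k := by omega
      have e3 : j - 1 + 1 = j := by omega
      simp [shiftRight, e1, e2, e3]
    · refine ⟨j, ?_⟩
      have e2 : ¬ (j < i + k) := by omega
      have e3 : ¬ (j = i + k) := by omega
      simp [shiftRight, h1, e2, e3]

/-- Every row of the array is a permutation of `ℕ`, so each value has exactly one position. -/
theorem hurtSada_bijective (n : ℕ) : Function.Bijective (hurtSada n) := by
  induction n with
  | zero => exact Function.bijective_id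
  | succ n ih => exact shiftRight_bijective ih _ _

theorem hurtSada_position (n v : ℕ) : hurtSada n (position (hurtSada n) v) = v :=
  Nat.sInf_mem (s := {i | hurtSada n i = v}) ((hurtSada_bijective n).2 v)

/-- The diagonal sequence `d'(n) = A[n - 1, n]` for `n ≥ 1`, with the convention `d'(0) = 0`. -/
noncomputable def dPrime : ℕ → ℕ
  | 0 => 0
  | n + 1 => hurtSada n (n + 1)

/-- A binary word, most significant digit first, with no two adjacent `1`s (leading zeros
are allowed). -/
def IsZeckendorf (w : List (Fin 2)) : Prop :=
  w.IsChain fun a b => ¬ (a = 1 ∧ b = 1)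

/-- The value of a binary word `a₁ a₂ ⋯ aₜ` in the Fibonacci numeration system,
`∑_{1 ≤ i ≤ t} aᵢ F_{t + 2 - i}`; below the index `i` runs from `0`. -/
def zeckendorfValue (w : List (Fin 2)) : ℕ :=
  ∑ i : Fin w.length, (w.get i : ℕ) * Nat.fib (w.length + 2 - (i + 1))

/-! An integer N has at most one index k with N = ⌊kφ⌋ or N = ⌊kφ²⌋. By induction on rows, the
entries inside a growing window are such indices minus one (`IsWythoffRow`), so d'(n) + 1 is the
index of 2n + 1 (`dPrime_wythoff`). This index is close to 2n/φ > n or to 2n/φ² < n, so d'(n) ≥ n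
exactly when 2n + 1 is a lower Wythoff number, and inverting the two floors gives the formulas.

For the automaton, let u be the value of the word w0. Then x = u - φn is a bounded sum of powers of
the conjugate 1 - φ, and each new digit acts on x by an affine map (`stateInterval_step`). The
interval containing x decides whether 2n + 1 is lower or upper (`le_dPrime_iff_of_stateInterval`).
-/

open Real in
theorem goldenRatio_bounds : (1.618 : ℝ) < goldenRatio ∧ goldenRatio < 1.6181 := by
  have h := goldenRatio_sq
  have h0 := goldenRatio_pos
  constructor <;> nlinarith

theorem natCast_mul_goldenRatio_ne (a b : ℕ) (ha : a ≠ 0) :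
    (a : ℝ) * Real.goldenRatio ≠ b :=
  (Real.goldenRatio_irrational.natCast_mul ha).ne_nat b

/-! ### Wythoff pair -/

/-- `N` is the `k`-th term of the lower Wythoff sequence `⌊k φ⌋`. -/
def IsLowerWythoff (k N : ℕ) : Prop :=
  (N : ℝ) < k * Real.goldenRatio ∧ k * Real.goldenRatio < N + 1

/-- `N` is the `k`-th term of the upper Wythoff sequence `⌊k φ²⌋ = ⌊k φ⌋ + k`. -/
def IsUpperWythoff (k N : ℕ) : Prop :=
  (N : ℝ) < k * Real.goldenRatio + k ∧ k * Real.goldenRatio + k < N + 1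

/-- Beatty's argument: since 1/φ + 1/φ² = 1, dividing the bounds by φ and φ² and adding gives N < k
+ l < N + 1. -/
theorem IsLowerWythoff.not_isUpperWythoff {k l N : ℕ} (h : IsLowerWythoff k N) :
    ¬ IsUpperWythoff l N := by
  rintro ⟨h3, h4⟩
  obtain ⟨h1, h2⟩ := h
  have hs := Real.goldenRatio_sq
  have h0 := Real.goldenRatio_pos
  have a : N < k + l := by
    have : (N : ℝ) < k + l := by nlinarith
    exact_mod_cast this
  have b : k + l < N + 1 := by
    have : (k + l : ℝ) < N + 1 := by nlinarith
    exact_mod_cast this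
  omega

theorem eq_of_mul_near {a : ℝ} (ha : 1 < a) {k l N : ℕ} (h1 : (N : ℝ) < k * a)
    (h2 : k * a < N + 1) (h3 : (N : ℝ) < l * a) (h4 : l * a < N + 1) : k = l := by
  rcases lt_trichotomy k l with h | h | h
  · have : (k + 1 : ℝ) ≤ l := by exact_mod_cast h
    nlinarith
  · exact h
  · have : (l + 1 : ℝ) ≤ k := by exact_mod_cast h
    nlinarith

theorem IsLowerWythoff.unique {k l N : ℕ} (h : IsLowerWythoff k N) (h' : IsLowerWythoff l N) :
    k = l :=
  eq_of_mul_near Real.one_lt_goldenRatio h.1 h.2 h'.1 h'.2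

theorem IsUpperWythoff.unique {k l N : ℕ} (h : IsUpperWythoff k N) (h' : IsUpperWythoff l N) :
    k = l := by
  obtain ⟨h1, h2⟩ := h
  obtain ⟨h3, h4⟩ := h'
  have := Real.goldenRatio_pos
  apply eq_of_mul_near (a := Real.goldenRatio + 1) (N := N) (by linarith) <;> linarith

theorem wythoff_unique {k l N : ℕ} (h : IsLowerWythoff k N ∨ IsUpperWythoff k N)
    (h' : IsLowerWythoff l N ∨ IsUpperWythoff l N) : k = l := by
  rcases h with h | h <;> rcases h' with h' | h'
  · exact h.unique h'
  · exact absurd h' h.not_isUpperWythoff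
  · exact absurd h h'.not_isUpperWythoff
  · exact h.unique h'

/-! ### Rows of the array -/

theorem position_eq (n p : ℕ) (v : ℕ) (h : hurtSada n p = v) : position (hurtSada n) v = p :=
  (hurtSada_bijective n).1 ((hurtSada_position n v).trans h.symm)

/-- Row `n` of the Hurt-Sada array is the identity outside the window
`(n + 2) / φ < j + 1 < (n + 1) φ`; inside it, the entry in column `j` is one less than the index
of `j + n + 2` in the Wythoff pair of complementary sequences. -/
structure IsWythoffRow (n : ℕ) (r : ℕ → ℕ) : Prop where
  left : ∀ j : ℕ, ((j : ℝ) + 1) * Real.goldenRatio < n + 2 → r j = j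
  right : ∀ j : ℕ, ((n : ℝ) + 1) * Real.goldenRatio < j + 1 → r j = j
  mid : ∀ j : ℕ, (n : ℝ) + 2 < (j + 1) * Real.goldenRatio →
    (j : ℝ) + 1 < (n + 1) * Real.goldenRatio →
    IsLowerWythoff (r j + 1) (j + n + 2) ∨ IsUpperWythoff (r j + 1) (j + n + 2)

theorem isWythoffRow_zero : IsWythoffRow 0 (hurtSada 0) where
  left _ _ := rfl
  right _ _ := rfl
  mid j h1 h2 := by
    obtain ⟨g1, g2⟩ := goldenRatio_bounds
    push_cast at *
    rcases Nat.eq_zero_or_pos j with rfl | hj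
    · norm_num at h1
      linarith
    · have : (1 : ℝ) ≤ j := by exact_mod_cast hj
      linarith

theorem exists_nat_mul_goldenRatio (n : ℕ) : ∃ p : ℕ, (p : ℝ) * Real.goldenRatio < n + 2 ∧
    (n : ℝ) + 2 < (p + 1) * Real.goldenRatio := by
  have h0 := Real.goldenRatio_pos
  refine ⟨⌊((n : ℝ) + 2) / Real.goldenRatio⌋₊, ?_, ?_⟩
  · have h := Nat.floor_le (show 0 ≤ ((n : ℝ) + 2) / Real.goldenRatio by positivity)
    rw [le_div_iff₀ h0] at h
    refine lt_of_le_of_ne h fun e => ?_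
    rcases eq_or_ne ⌊((n : ℝ) + 2) / Real.goldenRatio⌋₊ 0 with hz | hz
    · rw [hz] at e
      norm_num at e
      linarith [n.cast_nonneg (α := ℝ)]
    · exact natCast_mul_goldenRatio_ne _ (n + 2) hz (by push_cast; exact e)
  · have h := Nat.lt_floor_add_one (((n : ℝ) + 2) / Real.goldenRatio)
    rwa [div_lt_iff₀ h0] at h

/-- Here p = ⌊(n + 2)/φ⌋, and (n + 2)φ = (n + 2) + (n + 2)/φ, so n + 2 is the lower index of p + n +
2. -/
theorem IsWythoffRow.apply_eq_succ {n p : ℕ} {r : ℕ → ℕ} (hr : IsWythoffRow n r)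
    (hp : (p : ℝ) * Real.goldenRatio < n + 2) (hp' : (n : ℝ) + 2 < (p + 1) * Real.goldenRatio) :
    r p = n + 1 := by
  obtain ⟨g1, g2⟩ := goldenRatio_bounds
  have hs := Real.goldenRatio_sq
  -- The window of row 0 is empty, so there the identity part is used.
  rcases Nat.eq_zero_or_pos n with rfl | hn
  · have hp1 : p = 1 := by
      have a : p < 2 := by
        by_contra! h
        have : (2 : ℝ) ≤ p := by exact_mod_cast h
        push_cast at *
        nlinarith
      have b : p ≠ 0 := by
        rintro rfl
        push_cast at *
        linarith
      omega
    subst hp1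
    exact hr.right 1 (by norm_num; linarith)
  · have hn' : (1 : ℝ) ≤ n := by exact_mod_cast hn
    have key := hr.mid p hp' (by nlinarith)
    have : IsLowerWythoff (n + 2) (p + n + 2) := by
      constructor <;> push_cast <;> nlinarith
    have := wythoff_unique key (Or.inl this)
    omega

/-- Needed when column p leaves the window: the entry sliding into it must be p. -/
theorem IsWythoffRow.apply_succ_eq {n p : ℕ} {r : ℕ → ℕ} (hr : IsWythoffRow n r)
    (hp : (p : ℝ) * Real.goldenRatio < n + 2) (hp' : (n : ℝ) + 2 < (p + 1) * Real.goldenRatio)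
    (h : ((p : ℝ) + 1) * Real.goldenRatio < n + 3) : r (p + 1) = p := by
  obtain ⟨g1, g2⟩ := goldenRatio_bounds
  have hs := Real.goldenRatio_sq
  have hw : ((p + 1 : ℕ) : ℝ) + 1 < (n + 1) * Real.goldenRatio := by
    push_cast
    rcases Nat.lt_or_ge n 2 with hn | hn
    · have hp2 : p < 2 := by
        by_contra! h2
        have : (2 : ℝ) ≤ p := by exact_mod_cast h2
        have : (n : ℝ) ≤ 1 := by exact_mod_cast Nat.le_of_lt_succ hn
        nlinarith
      interval_cases n <;> interval_cases p <;> norm_num at * <;> linarith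
    · have : (2 : ℝ) ≤ n := by exact_mod_cast hn
      nlinarith
  have key := hr.mid (p + 1) (by push_cast; linarith) hw
  have : IsUpperWythoff (p + 1) (p + 1 + n + 2) := by
    constructor <;> push_cast <;> linarith
  have := wythoff_unique key (Or.inr this)
  omega

/-- One row down and one column left preserves j + n + 2, so the entries jumped over keep their
index. Only the edges of the window need an argument. -/
theorem IsWythoffRow.shiftRight {n p : ℕ} {r : ℕ → ℕ} (hr : IsWythoffRow n r)
    (hp : (p : ℝ) * Real.goldenRatio < n + 2) (hp' : (n : ℝ) + 2 < (p + 1) * Real.goldenRatio) :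
    IsWythoffRow (n + 1) (shiftRight r p (n + 1)) := by
  obtain ⟨g1, g2⟩ := goldenRatio_bounds
  have hs := Real.goldenRatio_sq
  -- Thus ⌊(n + 2)φ⌋ = n + 2 + p, and n + 1 lands in the last column p + n + 1 of the new window.
  have hlo : (n : ℝ) + 2 + p < (n + 2) * Real.goldenRatio := by nlinarith
  have hhi : ((n : ℝ) + 2) * Real.goldenRatio < n + 2 + p + 1 := by nlinarith
  refine ⟨fun j hj => ?_, fun j hj => ?_, fun j h1 h2 => ?_⟩
  · push_cast at hj
    rcases lt_trichotomy j p with h | rfl | h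
    · have : (j + 1 : ℝ) ≤ p := by exact_mod_cast h
      simp only [_root_.shiftRight, if_pos h]
      exact hr.left j (by nlinarith)
    · simp only [_root_.shiftRight, lt_irrefl, if_false, if_pos (show j < j + (n + 1) by omega)]
      exact hr.apply_succ_eq hp hp' (by linarith)
    · have : (p + 1 : ℝ) ≤ j := by exact_mod_cast h
      nlinarith
  · push_cast at hj
    have : n + 2 + p < j + 1 := by
      have : (n : ℝ) + 2 + p < j + 1 := by linarith
      exact_mod_cast this
    simp only [_root_.shiftRight, if_neg (show ¬ j < p by omega),
      if_neg (show ¬ j < p + (n + 1) by omega), if_neg (show ¬ j = p + (n + 1) by omega)]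
    exact hr.right j (by linarith)
  · push_cast at h1 h2
    have hj : p ≤ j := by
      by_contra! h
      have : (j + 1 : ℝ) ≤ p := by exact_mod_cast h
      nlinarith
    have hj' : j + 1 < n + 2 + p + 1 := by
      have : (j : ℝ) + 1 < n + 2 + p + 1 := by linarith
      exact_mod_cast this
    rcases Nat.lt_or_ge j (p + (n + 1)) with h | h
    · simp only [_root_.shiftRight, if_neg (show ¬ j < p by omega), if_pos h]
      have hc : (j : ℝ) + 2 ≤ n + 2 + p := by
        have : j + 2 ≤ n + 2 + p := by omega
        exact_mod_cast this
      rw [show j + (n + 1) + 2 = j + 1 + n + 2 by ring]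
      rcases lt_trichotomy (((j + 1 : ℕ) : ℝ) + 1) ((n + 1) * Real.goldenRatio) with h3 | h3 | h3
      · exact hr.mid (j + 1) (by push_cast; linarith) h3
      · exact absurd h3.symm
          (by exact_mod_cast natCast_mul_goldenRatio_ne (n + 1) (j + 1 + 1) (by omega))
      -- An identity entry enters the window; it has a lower index because n + 1 < (j + 2)/φ < n +
      -- 2.
      · rw [hr.right (j + 1) h3]
        push_cast at h3
        left
        constructor <;> push_cast <;> nlinarith
    · obtain rfl : j = p + (n + 1) := by omega
      simp only [_root_.shiftRight, if_neg (show ¬ p + (n + 1) < p by omega), lt_irrefl, if_false,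
        if_true]
      rw [hr.apply_eq_succ hp hp']
      right
      constructor <;> push_cast <;> linarith

theorem isWythoffRow_hurtSada (n : ℕ) : IsWythoffRow n (hurtSada n) := by
  induction n with
  | zero => exact isWythoffRow_zero
  | succ n ih =>
    obtain ⟨p, hp, hp'⟩ := exists_nat_mul_goldenRatio n
    have := position_eq n p (n + 1) (ih.apply_eq_succ hp hp')
    simp only [hurtSada, this]
    exact ih.shiftRight hp hp'

/-! ### The diagonal and its floor formulas -/

theorem dPrime_wythoff (n : ℕ) : IsLowerWythoff (dPrime n + 1) (2 * n + 1) ∨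
    IsUpperWythoff (dPrime n + 1) (2 * n + 1) := by
  obtain ⟨g1, g2⟩ := goldenRatio_bounds
  rcases n with _ | _ | n
  · left
    constructor <;> norm_num [dPrime] <;> linarith
  · left
    have : hurtSada 0 1 = 1 := rfl
    constructor <;> norm_num [dPrime, this] <;> linarith
  · have := (isWythoffRow_hurtSada (n + 1)).mid (n + 1 + 1)
      (by push_cast; nlinarith [n.cast_nonneg (α := ℝ)])
      (by push_cast; nlinarith [n.cast_nonneg (α := ℝ)])
    rwa [show n + 1 + 1 + (n + 1) + 2 = 2 * (n + 1 + 1) + 1 by ring] at this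

theorem le_dPrime_of_isLowerWythoff {n k : ℕ} (h : IsLowerWythoff k (2 * n + 1)) :
    n ≤ dPrime n := by
  obtain rfl := wythoff_unique (Or.inl h) (dPrime_wythoff n)
  obtain ⟨h1, h2⟩ := h
  obtain ⟨g1, g2⟩ := goldenRatio_bounds
  by_contra! hlt
  have : (dPrime n : ℝ) + 1 ≤ n := by exact_mod_cast hlt
  push_cast at *
  nlinarith

theorem dPrime_lt_of_isUpperWythoff {n k : ℕ} (h : IsUpperWythoff k (2 * n + 1)) :
    dPrime n < n := by
  obtain rfl := wythoff_unique (Or.inr h) (dPrime_wythoff n)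
  obtain ⟨h1, h2⟩ := h
  obtain ⟨g1, g2⟩ := goldenRatio_bounds
  by_contra! hlt
  have : (n : ℝ) ≤ dPrime n := by exact_mod_cast hlt
  push_cast at *
  nlinarith

/-- Inverting the lower floor gives φ - 2 < d'(n) - (2φ - 2)n < 2φ - 3, an interval inside (-1/2,
1/2). -/
theorem dPrime_eq_of_le {n : ℕ} (h : n ≤ dPrime n) :
    (dPrime n : ℤ) = ⌊(2 * Real.goldenRatio - 2) * (n : ℝ) + 1 / 2⌋ := by
  rcases dPrime_wythoff n with hw | hw
  · obtain ⟨h1, h2⟩ := hw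
    obtain ⟨g1, g2⟩ := goldenRatio_bounds
    have hs := Real.goldenRatio_sq
    symm
    rw [Int.floor_eq_iff]
    push_cast at *
    constructor <;> nlinarith
  · exact absurd (dPrime_lt_of_isUpperWythoff hw) (by omega)

theorem dPrime_eq_of_lt {n : ℕ} (h : dPrime n < n) :
    (dPrime n : ℤ) = ⌊(4 - 2 * Real.goldenRatio) * (n : ℝ)⌋ := by
  rcases dPrime_wythoff n with hw | hw
  · exact absurd (le_dPrime_of_isLowerWythoff hw) (by omega)
  · obtain ⟨h1, h2⟩ := hw
    obtain ⟨g1, g2⟩ := goldenRatio_bounds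
    have hs := Real.goldenRatio_sq
    symm
    rw [Int.floor_eq_iff]
    push_cast at *
    constructor <;> nlinarith

/-! ### Conjugate sums of words -/

/-- The value of a binary word with each Fibonacci number `F_i` replaced by `f i`. -/
noncomputable def wordSum (f : ℕ → ℝ) (w : List (Fin 2)) : ℝ :=
  ∑ i : Fin w.length, ((w.get i : ℕ) : ℝ) * f (w.length + 2 - (i + 1))

theorem wordSum_append_singleton (f : ℕ → ℝ) (w : List (Fin 2)) (c : Fin 2) :
    wordSum f (w ++ [c]) = wordSum (fun i => f (i + 1)) w + (c : ℕ) * f 2 := by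
  have key (v : List (Fin 2)) (g : ℕ → ℝ) : wordSum g v =
      ∑ i ∈ Finset.range v.length, ((v.getD i 0 : ℕ) : ℝ) * g (v.length + 2 - (i + 1)) := by
    rw [Finset.sum_range]
    simp [wordSum]
  rw [key, key, List.length_append, List.length_singleton, Finset.sum_range_succ]
  congr 1
  · refine Finset.sum_congr rfl fun i hi => ?_
    have hi := Finset.mem_range.1 hi
    rw [List.getD_append _ _ _ _ hi,
      show w.length + 1 + 2 - (i + 1) = w.length + 2 - (i + 1) + 1 by omega]
  · rw [List.getD_append_right _ _ _ _ le_rfl,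
      show w.length + 1 + 2 - (w.length + 1) = 2 by omega]
    simp

/-- The difference between the value of `w0` and `φ` times the value of `w`. -/
noncomputable def conjSum : List (Fin 2) → ℝ := wordSum (Real.goldenConj ^ ·)

theorem conjSum_nil : conjSum [] = 0 := by
  simp [conjSum, wordSum]

theorem conjSum_append_singleton (w : List (Fin 2)) (c : Fin 2) :
    conjSum (w ++ [c]) = (1 - Real.goldenRatio) * conjSum w + (c : ℕ) * (2 - Real.goldenRatio) := by
  rw [conjSum, wordSum_append_singleton, Real.goldenConj_sq, ← Real.one_sub_goldenRatio,
    wordSum, wordSum, Finset.mul_sum]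
  congr 1
  · refine Finset.sum_congr rfl fun i _ => ?_
    rw [pow_succ]
    ring
  · ring

/-- Termwise this is F_{i+1} = φF_i + (1 - φ)^i. -/
theorem exists_nat_eq_add_conjSum (w : List (Fin 2)) :
    ∃ u : ℕ, (u : ℝ) = Real.goldenRatio * zeckendorfValue w + conjSum w := by
  refine ⟨∑ i : Fin w.length, (w.get i : ℕ) * Nat.fib (w.length + 2 - (i + 1) + 1), ?_⟩
  rw [zeckendorfValue, conjSum, wordSum]
  push_cast
  rw [Finset.mul_sum, ← Finset.sum_add_distrib]
  refine Finset.sum_congr rfl fun i _ => ?_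
  rw [← Real.fib_succ_sub_goldenRatio_mul_fib]
  ring

/-! ### The automaton -/

theorem isZeckendorf_append_singleton (w : List (Fin 2)) (c : Fin 2) :
    IsZeckendorf (w ++ [c]) ↔ IsZeckendorf w ∧ ¬ (w.getLast? = some 1 ∧ c = 1) := by
  simp only [IsZeckendorf, List.isChain_append, List.isChain_singleton, true_and]
  refine and_congr_right fun _ => ?_
  simp [Option.mem_def]

/-- The automaton deciding `n ≤ dPrime n`; state `5` is the sink of words with two adjacent `1`s. -/
def leDPrimeDFA : DFA (Fin 2) (Fin 6) where
  step s a := (![![0, 1], ![2, 5], ![3, 1], ![0, 4], ![0, 5], ![5, 5]] : Fin 6 → Fin 2 → Fin 6) s a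
  start := 0
  accept := {0, 1}

/-- The open interval containing `conjSum w` for the words `w` that lead to a given state. -/
def stateInterval (x : ℝ) : Fin 6 → Prop :=
  ![Real.goldenRatio - 2 < 2 * x ∧ 2 * x < 2 * Real.goldenRatio - 3,
    Real.goldenRatio - 1 < 2 * x ∧ x < Real.goldenRatio - 1,
    Real.goldenRatio - 2 < x ∧ 2 * x < Real.goldenRatio - 2,
    2 * Real.goldenRatio - 3 < 2 * x ∧ x < 2 * Real.goldenRatio - 3,
    2 * Real.goldenRatio - 3 < x ∧ 2 * x < Real.goldenRatio - 1,
    True]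

theorem stateInterval_step {x : ℝ} {s : Fin 6} (h : stateInterval x s) (c : Fin 2) :
    stateInterval ((1 - Real.goldenRatio) * x + (c : ℕ) * (2 - Real.goldenRatio))
      (leDPrimeDFA.step s c) := by
  obtain ⟨g1, g2⟩ := goldenRatio_bounds
  have hs := Real.goldenRatio_sq
  fin_cases s <;> fin_cases c <;> simp [stateInterval, leDPrimeDFA] at h ⊢ <;>
    constructor <;> nlinarith [h.1, h.2]

/-- The clause on the last digit is what lets the induction detect two adjacent 1s. -/
theorem leDPrimeDFA_eval (w : List (Fin 2)) :
    (IsZeckendorf w ↔ leDPrimeDFA.eval w ≠ 5) ∧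
    (leDPrimeDFA.eval w ≠ 5 → (w.getLast? = some 1 ↔
      leDPrimeDFA.eval w = 1 ∨ leDPrimeDFA.eval w = 4)) ∧
    stateInterval (conjSum w) (leDPrimeDFA.eval w) := by
  obtain ⟨g1, g2⟩ := goldenRatio_bounds
  induction w using List.reverseRecOn with
  | nil =>
    refine ⟨by simp [IsZeckendorf, leDPrimeDFA], by simp [leDPrimeDFA], ?_⟩
    simp [conjSum_nil, stateInterval, leDPrimeDFA]
    constructor <;> linarith
  | append_singleton w c ih =>
    obtain ⟨h1, h2, h3⟩ := ih
    rw [DFA.eval_append_singleton, conjSum_append_singleton, isZeckendorf_append_singleton]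
    refine ⟨?_, ?_, stateInterval_step h3 c⟩
    · rw [h1]
      generalize leDPrimeDFA.eval w = s at *
      by_cases hs : s = 5
      · subst hs
        fin_cases c <;> simp [leDPrimeDFA]
      · rw [h2 hs]
        clear h1 h2 h3
        revert s c
        decide
    · generalize leDPrimeDFA.eval w = s at *
      rw [List.getLast?_concat]
      clear h1 h2 h3
      revert s c
      decide

/-- Each state supplies an explicit index of 2n + 1, linear in n and u; it is taken in ℤ because of
the subtraction. -/
theorem le_dPrime_iff_of_stateInterval {n u : ℕ} {x : ℝ} {s : Fin 6} (hs : s ≠ 5)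
    (hu : (u : ℝ) = Real.goldenRatio * n + x) (h : stateInterval x s) :
    n ≤ dPrime n ↔ s = 0 ∨ s = 1 := by
  obtain ⟨g1, g2⟩ := goldenRatio_bounds
  have hsq := Real.goldenRatio_sq
  have lower (k : ℤ) (h1 : (2 * n + 1 : ℝ) < k * Real.goldenRatio)
      (h2 : k * Real.goldenRatio < 2 * n + 1 + 1) : n ≤ dPrime n := by
    have hk : 0 ≤ k := by
      by_contra! hk
      have : (k : ℝ) < 0 := by exact_mod_cast hk
      nlinarith [n.cast_nonneg (α := ℝ)]
    lift k to ℕ using hk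
    exact le_dPrime_of_isLowerWythoff (k := k)
      ⟨by push_cast at *; linarith, by push_cast at *; linarith⟩
  have upper (k : ℤ) (h1 : (2 * n + 1 : ℝ) < k * Real.goldenRatio + k)
      (h2 : k * Real.goldenRatio + k < 2 * n + 1 + 1) : ¬ n ≤ dPrime n := by
    have hk : 0 ≤ k := by
      by_contra! hk
      have : (k : ℝ) < 0 := by exact_mod_cast hk
      nlinarith [n.cast_nonneg (α := ℝ)]
    lift k to ℕ using hk
    exact not_le.2 (dPrime_lt_of_isUpperWythoff (k := k)
      ⟨by push_cast at *; linarith, by push_cast at *; linarith⟩)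
  obtain rfl : x = u - Real.goldenRatio * n := by linarith
  fin_cases s <;> simp [stateInterval] at h hs ⊢
  -- As φ² = φ + 1, this index times φ is 2n + (2x + 1)φ; the interval of state 0 says exactly 1 <
  -- (2x + 1)φ < 2.
  · apply lower (2 * u - 2 * n + 1) <;> push_cast <;> nlinarith [h.1, h.2]
  · apply lower (2 * u - 2 * n) <;> push_cast <;> nlinarith [h.1, h.2]
  · apply lt_of_not_ge
    -- This index times φ² is 2n - 2xφ²; for the next two states the excess over 2n is (1 - 2x)φ².
    apply upper (4 * n - 2 * u) <;> push_cast <;> nlinarith [h.1, h.2]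
  · apply lt_of_not_ge
    apply upper (4 * n + 1 - 2 * u) <;> push_cast <;> nlinarith [h.1, h.2]
  · apply lt_of_not_ge
    apply upper (4 * n + 1 - 2 * u) <;> push_cast <;> nlinarith [h.1, h.2]

theorem mem_accepts_leDPrimeDFA (w : List (Fin 2)) :
    w ∈ leDPrimeDFA.accepts ↔
      IsZeckendorf w ∧ zeckendorfValue w ≤ dPrime (zeckendorfValue w) := by
  obtain ⟨h1, -, h3⟩ := leDPrimeDFA_eval w
  obtain ⟨u, hu⟩ := exists_nat_eq_add_conjSum w
  have hacc : w ∈ leDPrimeDFA.accepts ↔ leDPrimeDFA.eval w = 0 ∨ leDPrimeDFA.eval w = 1 :=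
    Iff.rfl
  rw [hacc, h1]
  by_cases hs : leDPrimeDFA.eval w = 5
  · simp [hs]
  · rw [le_dPrime_iff_of_stateInterval hs hu h3]
    simp [hs]

theorem theorem9 :
    (∃ M : DFA (Fin 2) (Fin 6), ∀ w : List (Fin 2),
      w ∈ M.accepts ↔ IsZeckendorf w ∧ zeckendorfValue w ≤ dPrime (zeckendorfValue w)) ∧
    (∀ n : ℕ, n ≤ dPrime n →
      (dPrime n : ℤ) = ⌊(2 * Real.goldenRatio - 2) * (n : ℝ) + 1 / 2⌋) ∧
    (∀ n : ℕ, dPrime n < n →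
      (dPrime n : ℤ) = ⌊(4 - 2 * Real.goldenRatio) * (n : ℝ)⌋) :=
  ⟨⟨leDPrimeDFA, mem_accepts_leDPrimeDFA⟩, fun _ => dPrime_eq_of_le, fun _ => dPrime_eq_of_lt⟩
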